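/- Let $\mathcal H$ be a real Hilbert space and let $S\colon\mathcal H\to\mathcal H$ be a bounded self-adjoint linear operator that is strongly positive, i.e. there is $m>0$ with $\langle Sx,x\rangle\ge m\|x\|^2$ for all $x\in\mathcal H$ (so $S$ is invertible). Write $\|x\|_S=\sqrt{\langle Sx,x\rangle}$ and $\|x\|_{S^{-1}}=\sqrt{\langle S^{-1}x,x\rangle}$. Let $A\colon\mathcal H\to2^{\mathcal H}$ be maximally monotone, and let $C\colon\mathcal H\to\mathcal H$ and $\ell$ be such that either $\ell>0$ and $C$ is $\ell^{-1}$-cocoercive w.r.t. $S$, i.e. $\langle Cx-Cy,x-y\rangle\ge\ell^{-1}\|Cx-Cy\|_{S^{-1}}^2$ for all $x,y\in\mathcal H$, or $C=0$ and $\ell=0$. Assume $\operatorname{zer}(A+C)=\{x\in\mathcal H: 0\in Ax+Cx\}\ne\emptyset$. For each $k\in\mathbb N=\{0,1,\dots\}$ let $M_k\colon\mathcal H\to\mathcal H$, $\gamma_k\in\mathbb R$ and $L_k\ge0$ be such that $\gamma_kM_k-S$ is $L_k$-Lipschitz continuous w.r.t. $S$, i.e. $\|(\gamma_kM_k-S)x-(\gamma_kM_k-S)y\|_{S^{-1}}\le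 L_k\|x-y\|_S$ for all $x,y\in\mathcal H$, and suppose that there is $\gamma>0$ with $\gamma_k\ge\gamma$ for all $k\in\mathbb N$. Suppose that there is $\epsilon>0$ such that $$1-L_{k-1}-L_k-\tfrac{\gamma_k\ell}{2}\ge\epsilon\qquad\text{for all }k\ge1.$$ Let $x_0,u_0\in\mathcal H$ be arbitrary and let $(x_k)_{k\in\mathbb N}$, $(u_k)_{k\in\mathbb N}$ be generated by the nonlinear forward-backward method with momentum correction: for all $k\in\mathbb N$, $$x_{k+1}=(M_k+A)^{-1}(M_kx_k-Cx_k+\gamma_k^{-1}u_k),\qquad u_{k+1}=(\gamma_kM_k-S)x_{k+1}-(\gamma_kM_k-S)x_k,$$ where the first equation means that $M_kx_k-Cx_k+\gamma_k^{-1}u_k\in M_kx_{k+1}+Ax_{k+1}$. Then: 1. $x_{k+1}-x_k\to0$ as $k\to\infty$; 2. $u_k\to0$ as $k\to\infty$; 3. $M_kx_k-M_kx_{k+1}+\gamma_k^{-1}u_k+Cx_{k+1}-Cx_k\in(A+C)x_{k+1}$ for all $k\in\mathbb N$, and these elements tend to $0$ as $k\to\infty$; 4. there is $x^\star\in\operatorname{zer}(A+C)$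 such that $x_k$ converges weakly to $x^\star$. -/

import Mathlib

open Filter Topology

namespace NonlinearFB

variable {H : Type*} [NormedAddCommGroup H] [InnerProductSpace ℝ H]

/-- Membership in `𝒫(H)`: a bounded linear operator that is self-adjoint and strongly positive. -/
structure SelfAdjointStronglyPositive [CompleteSpace H] (S : H →L[ℝ] H) : Prop where
  isSelfAdjoint : IsSelfAdjoint S
  stronglyPositive : ∃ m : ℝ, 0 < m ∧ ∀ x : H, m * ‖x‖ ^ 2 ≤ inner ℝ (S x) x

/-- Operators in `𝒫(H)` are invertible, so that `S.inverse` below is the genuine inverse of `S`. -/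
theorem SelfAdjointStronglyPositive.isInvertible [CompleteSpace H] {S : H →L[ℝ] H}
    (hS : SelfAdjointStronglyPositive S) : S.IsInvertible := by
  obtain ⟨m, hm, h⟩ := hS.stronglyPositive
  have hc : IsCoercive ((innerSL ℝ).comp S : H →L[ℝ] H →L[ℝ] ℝ) := by
    refine ⟨m, hm, fun x => ?_⟩
    have := h x
    simpa [mul_assoc, pow_two] using this
  refine ⟨hc.continuousLinearEquivOfBilin, ?_⟩
  ext x
  symm
  apply hc.unique_continuousLinearEquivOfBilin
  intro w
  simp

/-- The scaled norm `‖x‖_S = √⟨S x, x⟩`. -/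
noncomputable def scaledNorm (S : H →L[ℝ] H) (x : H) : ℝ :=
  Real.sqrt (inner ℝ (S x) x)

/-- `B` is `L`-Lipschitz continuous w.r.t. `S`. -/
def LipschitzWrt (S : H →L[ℝ] H) (L : ℝ) (B : H → H) : Prop :=
  0 ≤ L ∧ ∀ x y : H, scaledNorm S.inverse (B x - B y) ≤ L * scaledNorm S (x - y)

/-- `C` is `ℓ⁻¹`-cocoercive w.r.t. `S`, where `ℓ > 0`. -/
def CocoerciveWrt (S : H →L[ℝ] H) (ℓ : ℝ) (C : H → H) : Prop :=
  0 < ℓ ∧ ∀ x y : H, ℓ⁻¹ * scaledNorm S.inverse (C x - C y) ^ 2 ≤ inner ℝ (C x - C y) (x - y)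

/-- The graph of a set-valued operator `A : H → 2^H`. -/
def graph (A : H → Set H) : Set (H × H) := {p | p.2 ∈ A p.1}

def IsMonotone (A : H → Set H) : Prop :=
  ∀ x u y v : H, (x, u) ∈ graph A → (y, v) ∈ graph A → 0 ≤ inner ℝ (u - v) (x - y)

/-- Monotone, with a graph that is not a proper subset of the graph of a monotone operator. -/
def IsMaximallyMonotone (A : H → Set H) : Prop :=
  IsMonotone A ∧ ∀ B : H → Set H, IsMonotone B → ¬ graph A ⊂ graph B

/-- The sum `A + B` of a set-valued operator `A` and a single-valued operator `B`. -/
def sumOp (A : H → Set H) (B : H → H) : H → Set H :=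
  fun x => {v | ∃ a ∈ A x, v = a + B x}

/-- The inverse of a set-valued operator: `x ∈ A⁻¹ y` if and only if `y ∈ A x`. -/
def inverseOp (A : H → Set H) : H → Set H :=
  fun y => {x | y ∈ A x}

def zer (A : H → Set H) : Set H := {x | 0 ∈ A x}

/-- `(x_k)` and `(u_k)` are generated, from the starting points `x 0` and `u 0`, by the nonlinear
forward-backward method with momentum correction, with kernels `M_k` and parameters `γ_k`:
`x_{k+1} = (M_k + A)⁻¹ (M_k x_k - C x_k + γ_k⁻¹ u_k)` and
`u_{k+1} = (γ_k M_k - S) x_{k+1} - (γ_k M_k - S) x_k`.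
The first line is read as membership in the value of the set-valued inverse. -/
structure IsGenerated (A : H → Set H) (C : H → H) (S : H →L[ℝ] H) (M : ℕ → H → H) (γ : ℕ → ℝ)
    (x u : ℕ → H) : Prop where
  x_step : ∀ k : ℕ,
    x (k + 1) ∈ inverseOp (sumOp A (M k)) (M k (x k) - C (x k) + (γ k)⁻¹ • u k)
  u_step : ∀ k : ℕ,
    u (k + 1) = (γ k • M k (x (k + 1)) - S (x (k + 1))) - (γ k • M k (x k) - S (x k))

end NonlinearFB

/-! For a zero z of A + C put D_k = ‖x_{k+1} - x_k‖_S and V_k = ‖x_{k+1} - z‖_S² + 2⟨u_{k+1},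
x_{k+1} - z⟩ + L_k D_k². The Lipschitz bound ‖u_{k+1}‖_{S⁻¹} ≤ L_k D_k gives V_k ≥ ε‖x_{k+1} -
z‖_S², and monotonicity of A with cocoercivity of C gives V_{k+1} ≤ V_k - ε D_{k+1}²
(`energy_step`). So V_k converges, D_k and u_k vanish, and the distance to every zero converges
(`fejer`). Multiplying the residual in A + C by γ_k removes M_k up to S and the corrections u, so
the residual vanishes too. Weak cluster points are then zeros (`neg_mem_of_tendsto`), and Opial's
lemma yields one weak limit. -/

namespace NonlinearFB

/-! ### The norms of S and S⁻¹ -/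

section ScaledNorm

theorem scaledNorm_nonneg {H : Type*} [NormedAddCommGroup H] [InnerProductSpace ℝ H] (S : H →L[ℝ] H)
    (x : H) : 0 ≤ scaledNorm S x :=
  Real.sqrt_nonneg _

variable {H : Type*} [NormedAddCommGroup H] [InnerProductSpace ℝ H] [CompleteSpace H]
  {S : H →L[ℝ] H}

theorem SelfAdjointStronglyPositive.inner_map_comm (hS : SelfAdjointStronglyPositive S) (x y : H) :
    inner ℝ (S x) y = inner ℝ (S y) x := by
  rw [real_inner_comm x (S y)]
  exact hS.isSelfAdjoint.isSymmetric x y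

theorem SelfAdjointStronglyPositive.inner_map_self_nonneg (hS : SelfAdjointStronglyPositive S)
    (x : H) : 0 ≤ inner ℝ (S x) x := by
  obtain ⟨m, hm, h⟩ := hS.stronglyPositive
  exact le_trans (by positivity) (h x)

theorem SelfAdjointStronglyPositive.sq_scaledNorm (hS : SelfAdjointStronglyPositive S) (x : H) :
    scaledNorm S x ^ 2 = inner ℝ (S x) x :=
  Real.sq_sqrt (hS.inner_map_self_nonneg x)

theorem SelfAdjointStronglyPositive.scaledNorm_inverse_map (hS : SelfAdjointStronglyPositive S)
    (x : H) : scaledNorm S.inverse (S x) = scaledNorm S x := by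
  rw [scaledNorm, scaledNorm, hS.isInvertible.inverse_apply_self, real_inner_comm]

/-- The Cauchy–Schwarz inequality for the norms induced by `S⁻¹` and `S`. -/
theorem SelfAdjointStronglyPositive.abs_inner_le (hS : SelfAdjointStronglyPositive S) (u d : H) :
    |inner ℝ u d| ≤ scaledNorm S.inverse u * scaledNorm S d := by
  -- With u = S w this is Cauchy–Schwarz for the form ⟨S·, ·⟩, proved by the discriminant of t ↦
  -- ⟨S(w + td), w + td⟩.
  obtain ⟨w, rfl⟩ := hS.isInvertible.surjective u
  rw [hS.scaledNorm_inverse_map]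
  refine abs_le_of_sq_le_sq ?_ (mul_nonneg (scaledNorm_nonneg S w) (scaledNorm_nonneg S d))
  rw [mul_pow, hS.sq_scaledNorm, hS.sq_scaledNorm]
  have h : ∀ t : ℝ, 0 ≤ inner ℝ (S d) d * (t * t) + 2 * inner ℝ (S w) d * t + inner ℝ (S w) w := by
    intro t
    have h0 := hS.inner_map_self_nonneg (w + t • d)
    simp only [map_add, map_smul, inner_add_left, inner_add_right, inner_smul_left,
      inner_smul_right, RCLike.conj_to_real, hS.inner_map_comm d w] at h0
    linarith
  have h1 := discrim_le_zero h
  rw [discrim] at h1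
  linarith

theorem SelfAdjointStronglyPositive.exists_norm_le (hS : SelfAdjointStronglyPositive S) :
    ∃ K : ℝ, 0 ≤ K ∧ ∀ x : H, ‖x‖ ≤ K * scaledNorm S x := by
  obtain ⟨m, hm, h⟩ := hS.stronglyPositive
  refine ⟨√m⁻¹, Real.sqrt_nonneg _, fun x => ?_⟩
  rw [scaledNorm, ← Real.sqrt_mul (by positivity)]
  refine Real.le_sqrt_of_sq_le ?_
  rw [inv_mul_eq_div, le_div_iff₀ hm, mul_comm]
  exact h x

theorem SelfAdjointStronglyPositive.exists_norm_le_inverse (hS : SelfAdjointStronglyPositive S) :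
    ∃ K : ℝ, 0 ≤ K ∧ ∀ u : H, ‖u‖ ≤ K * scaledNorm S.inverse u := by
  obtain ⟨K, hK, h⟩ := hS.exists_norm_le
  refine ⟨‖S‖ * K, by positivity, fun u => ?_⟩
  obtain ⟨w, rfl⟩ := hS.isInvertible.surjective u
  rw [hS.scaledNorm_inverse_map, mul_assoc]
  exact (S.le_opNorm w).trans (by gcongr; exact h w)

theorem SelfAdjointStronglyPositive.tendsto_of_scaledNorm {ι : Type*} {F : Filter ι}
    (hS : SelfAdjointStronglyPositive S) {f : ι → H}
    (hf : Tendsto (fun i => scaledNorm S (f i)) F (𝓝 0)) : Tendsto f F (𝓝 0) := by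
  obtain ⟨K, -, h⟩ := hS.exists_norm_le
  exact squeeze_zero_norm (fun i => h (f i)) (by simpa using hf.const_mul K)

theorem SelfAdjointStronglyPositive.tendsto_of_scaledNorm_inverse {ι : Type*} {F : Filter ι}
    (hS : SelfAdjointStronglyPositive S) {f : ι → H}
    (hf : Tendsto (fun i => scaledNorm S.inverse (f i)) F (𝓝 0)) : Tendsto f F (𝓝 0) := by
  obtain ⟨K, -, h⟩ := hS.exists_norm_le_inverse
  exact squeeze_zero_norm (fun i => h (f i)) (by simpa using hf.const_mul K)

end ScaledNorm

/-! ### Weak convergence and Opial's lemma -/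

section Weak

variable {H : Type*} [NormedAddCommGroup H] [InnerProductSpace ℝ H]

/-- Split a = (a - b) + b: the first part pairs with a bounded family, the second is fixed. The
bound is assumed because weak convergence along a general filter does not supply one. -/
theorem tendsto_inner_of_weak {ι : Type*} {F : Filter ι} {a y : ι → H} {b z : H} {R : ℝ}
    (ha : Tendsto a F (𝓝 b)) (hR : ∀ i, ‖y i‖ ≤ R)
    (hy : ∀ w, Tendsto (fun i => inner ℝ (y i) w) F (𝓝 (inner ℝ z w))) :
    Tendsto (fun i => inner ℝ (a i) (y i)) F (𝓝 (inner ℝ b z)) := by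
  have h0 : Tendsto (fun i => inner ℝ (a i - b) (y i)) F (𝓝 0) := by
    have h1 : Tendsto (fun i => ‖a i - b‖ * R) F (𝓝 0) := by
      simpa using (tendsto_iff_norm_sub_tendsto_zero.1 ha).mul_const R
    exact squeeze_zero_norm (fun i => (norm_inner_le_norm _ _).trans
      (mul_le_mul_of_nonneg_left (hR i) (norm_nonneg _))) h1
  have h2 := h0.add (hy b)
  rw [zero_add, real_inner_comm] at h2
  refine h2.congr fun i => ?_
  rw [inner_sub_left, real_inner_comm b (y i)]
  ring

theorem tendsto_toWeakSpace_iff [CompleteSpace H] {ι : Type*} {F : Filter ι} {y : ι → H} {z : H} :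
    Tendsto (fun i => toWeakSpace ℝ H (y i)) F (𝓝 (toWeakSpace ℝ H z)) ↔
      ∀ w, Tendsto (fun i => inner ℝ (y i) w) F (𝓝 (inner ℝ z w)) := by
  have key : Tendsto (fun i => toWeakSpace ℝ H (y i)) F (𝓝 (toWeakSpace ℝ H z)) ↔
      ∀ f : StrongDual ℝ H, Tendsto (fun i => f (y i)) F (𝓝 (f z)) :=
    WeakBilin.tendsto_iff_forall_eval_tendsto (topDualPairing ℝ H).flip
      fun x x' hxx' => ext_inner_right ℝ fun w => by
        simpa [real_inner_comm] using
          LinearMap.congr_fun hxx' (InnerProductSpace.toDual ℝ H w)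
  rw [key]
  constructor
  · intro h w
    simpa [real_inner_comm] using h (InnerProductSpace.toDual ℝ H w)
  · intro h f
    obtain ⟨w, rfl⟩ := (InnerProductSpace.toDual ℝ H).surjective f
    simpa [real_inner_comm] using h w

/-- Banach–Alaoglu transported by the Riesz isometry; ultrafilters replace weakly convergent
subsequences. -/
theorem exists_weak_limit_of_norm_le [CompleteSpace H] {ι : Type*} (F : Ultrafilter ι) {y : ι → H}
    {R : ℝ} (hR : ∀ i, ‖y i‖ ≤ R) :
    ∃ z : H, ∀ w, Tendsto (fun i => inner ℝ (y i) w) F (𝓝 (inner ℝ z w)) := by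
  have hc := WeakDual.isCompact_closedBall (𝕜 := ℝ) (E := H) 0 R
  let φ : ι → WeakDual ℝ H := fun i => StrongDual.toWeakDual (InnerProductSpace.toDual ℝ H (y i))
  obtain ⟨g, -, hg⟩ := hc.ultrafilter_le_nhds' (F.map φ)
    (Filter.mem_map.2 (Filter.univ_mem' fun i => by
      simpa [φ] using hR i))
  refine ⟨(InnerProductSpace.toDual ℝ H).symm (WeakDual.toStrongDual g), fun w => ?_⟩
  rw [InnerProductSpace.toDual_symm_apply]
  exact ((WeakDual.eval_continuous w).tendsto g).comp hg

/-- Opial's lemma in the metric of `S`. -/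
theorem SelfAdjointStronglyPositive.exists_weak_limit_of_fejer [CompleteSpace H] {S : H →L[ℝ] H}
    (hS : SelfAdjointStronglyPositive S) {Z : Set H} {y : ℕ → H} {R : ℝ} (hR : ∀ k, ‖y k‖ ≤ R)
    (hdist : ∀ z ∈ Z, ∃ l, Tendsto (fun k => inner ℝ (S (y k - z)) (y k - z)) atTop (𝓝 l))
    (hZ : ∀ F : Ultrafilter ℕ, (F : Filter ℕ) ≤ atTop → ∀ z,
      (∀ w, Tendsto (fun k => inner ℝ (y k) w) F (𝓝 (inner ℝ z w))) → z ∈ Z) :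
    ∃ z ∈ Z, ∀ w, Tendsto (fun k => inner ℝ (y k) w) atTop (𝓝 (inner ℝ z w)) := by
  obtain ⟨z, hz⟩ := exists_weak_limit_of_norm_le (Filter.hyperfilter ℕ) hR
  have hF0 : (Filter.hyperfilter ℕ : Filter ℕ) ≤ atTop := Nat.hyperfilter_le_atTop
  have hzZ := hZ _ hF0 z hz
  refine ⟨z, hzZ, fun w => ?_⟩
  rw [tendsto_iff_ultrafilter]
  intro G hG
  obtain ⟨z', hz'⟩ := exists_weak_limit_of_norm_le G hR
  have hzZ' := hZ G hG z' hz'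
  obtain ⟨l, hl⟩ := hdist z hzZ
  obtain ⟨l', hl'⟩ := hdist z' hzZ'
  -- The difference of the squared S-distances to z and z' is affine in y k, so this pairing
  -- converges along the whole sequence. Hence z and z' pair equally with S (z' - z), which forces
  -- z' = z.
  have hconv : Tendsto (fun k => inner ℝ (y k) (S (z' - z))) atTop
      (𝓝 ((l - l' - inner ℝ (S z) z + inner ℝ (S z') z') / 2)) := by
    refine ((((hl.sub hl').sub_const _).add_const _).div_const 2).congr fun k => ?_
    have h1 := hS.inner_map_comm (y k) z
    have h2 := hS.inner_map_comm (y k) z'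
    rw [real_inner_comm (S (z' - z)) (y k)]
    simp only [map_sub, inner_sub_left, inner_sub_right]
    linarith
  have h1 := tendsto_nhds_unique (hz _) (hconv.mono_left hF0)
  have h2 := tendsto_nhds_unique (hz' _) (hconv.mono_left hG)
  have h3 : inner ℝ (S (z' - z)) (z' - z) = 0 := by
    rw [real_inner_comm, inner_sub_left, h1, h2, sub_self]
  have h4 : z' = z := by
    obtain ⟨m, hm, h⟩ := hS.stronglyPositive
    have h5 := h (z' - z)
    rw [h3] at h5
    have h6 : ‖z' - z‖ ^ 2 ≤ 0 := by nlinarith [sq_nonneg ‖z' - z‖]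
    exact sub_eq_zero.1 (norm_eq_zero.1 (pow_eq_zero_iff two_ne_zero |>.1
      (le_antisymm h6 (sq_nonneg _))))
  rw [← h4]
  exact hz' w

end Weak

/-! ### Maximal monotonicity -/

section Monotone

variable {H : Type*} [NormedAddCommGroup H] [InnerProductSpace ℝ H]

theorem IsMaximallyMonotone.mem_of_forall {A : H → Set H} (hA : IsMaximallyMonotone A) {x u : H}
    (h : ∀ y v, v ∈ A y → 0 ≤ inner ℝ (u - v) (x - y)) : u ∈ A x := by
  by_contra hu
  -- Adjoining the single point (x, u) to the graph would give a proper monotone extension.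
  refine hA.2 (fun y => {v | v ∈ A y ∨ (y = x ∧ v = u)}) ?_ ?_
  · rintro y v y' v' (hv | ⟨rfl, rfl⟩) (hv' | ⟨h1, h2⟩)
    · exact hA.1 _ _ _ _ hv hv'
    · simp only at h1 h2
      subst h1 h2
      have := h y v hv
      rwa [← neg_sub v v', ← neg_sub y y', inner_neg_neg] at this
    · exact h _ _ hv'
    · simp only at h1 h2
      subst h1 h2
      simp
  · exact ⟨fun p hp => Or.inl hp, fun hsub => hu (hsub (a := (x, u)) (Or.inr ⟨rfl, rfl⟩))⟩

/-- The graph of a maximally monotone operator is weak-strong closed along bounded families. -/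
theorem IsMaximallyMonotone.mem_of_tendsto {A : H → Set H} (hA : IsMaximallyMonotone A)
    {ι : Type*} {F : Filter ι} [F.NeBot] {a y : ι → H} {b z : H} {R : ℝ}
    (hmem : ∀ i, a i ∈ A (y i)) (ha : Tendsto a F (𝓝 b)) (hR : ∀ i, ‖y i‖ ≤ R)
    (hy : ∀ w, Tendsto (fun i => inner ℝ (y i) w) F (𝓝 (inner ℝ z w))) : b ∈ A z := by
  refine hA.mem_of_forall fun x v hv => ?_
  have hlim := tendsto_inner_of_weak (z := z - x) (y := fun i => y i - x) (R := R + ‖x‖)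
    (ha.sub_const v) (fun i => (norm_sub_le _ _).trans (by gcongr; exact hR i)) (fun w => by
      simpa only [inner_sub_left] using (hy w).sub_const _)
  exact ge_of_tendsto' hlim fun i => hA.1 _ _ _ _ (hmem i) hv

end Monotone

/-! ### One-step estimates -/

section Method

variable {H : Type*} [NormedAddCommGroup H] [InnerProductSpace ℝ H] {S : H →L[ℝ] H}

/-- Cocoercivity with constant `ℓ⁻¹`, where `ℓ = 0` is allowed for `C = 0`, in division-free form. -/
theorem cocoercive_bounds {C : H → H} {ℓ : ℝ}
    (hC : CocoerciveWrt S ℓ C ∨ (C = 0 ∧ ℓ = 0)) :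
    0 ≤ ℓ ∧ (∀ x y, 0 ≤ inner ℝ (C x - C y) (x - y)) ∧
      ∀ x y, scaledNorm S.inverse (C x - C y) ^ 2 ≤ ℓ * inner ℝ (C x - C y) (x - y) := by
  rcases hC with ⟨hℓ, h⟩ | ⟨rfl, rfl⟩
  · refine ⟨hℓ.le, fun x y => le_trans (by positivity) (h x y), fun x y => ?_⟩
    have := h x y
    rwa [inv_mul_le_iff₀ hℓ] at this
  · simp [scaledNorm]

theorem SelfAdjointStronglyPositive.scaledNorm_inverse_le_of_cocoercive [CompleteSpace H]
    (hS : SelfAdjointStronglyPositive S) {c d : H} {ℓ : ℝ} (hℓ : 0 ≤ ℓ)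
    (h : scaledNorm S.inverse c ^ 2 ≤ ℓ * inner ℝ c d) :
    scaledNorm S.inverse c ≤ ℓ * scaledNorm S d := by
  have h1 : scaledNorm S.inverse c ^ 2 ≤ ℓ * (scaledNorm S.inverse c * scaledNorm S d) :=
    h.trans (mul_le_mul_of_nonneg_left ((le_abs_self _).trans (hS.abs_inner_le c d)) hℓ)
  rcases (scaledNorm_nonneg S.inverse c).eq_or_lt with h0 | h0
  · rw [← h0]
    exact mul_nonneg hℓ (scaledNorm_nonneg S d)
  · refine le_of_mul_le_mul_left ?_ h0
    linarith

/-- Young's inequality absorbs ⟨c, d⟩ into the cocoercivity term ⟨c, e⟩. It bounds the cost of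
evaluating C at the old point, the source of γℓ/2 in the step-size condition. -/
theorem SelfAdjointStronglyPositive.neg_inner_add_le_of_cocoercive [CompleteSpace H]
    (hS : SelfAdjointStronglyPositive S) {c e d : H} {ℓ : ℝ} (hℓ : 0 ≤ ℓ)
    (h0 : 0 ≤ inner ℝ c e) (h : scaledNorm S.inverse c ^ 2 ≤ ℓ * inner ℝ c e) :
    -(2 * inner ℝ c (e + d)) ≤ ℓ / 2 * scaledNorm S d ^ 2 := by
  have h1 := (abs_le.1 (hS.abs_inner_le c d)).1
  have hd := scaledNorm_nonneg S d
  have h2 : 2 * (scaledNorm S.inverse c * scaledNorm S d) ≤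
      2 * inner ℝ c e + ℓ / 2 * scaledNorm S d ^ 2 := by
    -- Comparing squares avoids ℓ⁻¹, so ℓ = 0 needs no separate case.
    refine abs_le_of_sq_le_sq' ?_ (by positivity) |>.2
    have h3 := mul_le_mul_of_nonneg_right h (sq_nonneg (scaledNorm S d))
    nlinarith [sq_nonneg (2 * inner ℝ c e - ℓ / 2 * scaledNorm S d ^ 2)]
  rw [inner_add_right]
  linarith

/-- The one-step energy inequality of the method. -/
theorem SelfAdjointStronglyPositive.energy_step [CompleteSpace H]
    (hS : SelfAdjointStronglyPositive S)
    {x x' z u u' c : H} {γ ℓ L D : ℝ} (hγ : 0 ≤ γ) (hℓ : 0 ≤ ℓ) (hL : 0 ≤ L)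
    (hmono : 0 ≤ inner ℝ (S (x - x') + u - u' - γ • c) (x' - z))
    (hc0 : 0 ≤ inner ℝ c (x - z))
    (hc : scaledNorm S.inverse c ^ 2 ≤ ℓ * inner ℝ c (x - z))
    (hu : scaledNorm S.inverse u ≤ L * D) :
    scaledNorm S (x' - z) ^ 2 + 2 * inner ℝ u' (x' - z) ≤
      scaledNorm S (x - z) ^ 2 + 2 * inner ℝ u (x - z) + L * D ^ 2
        - (1 - L - γ * ℓ / 2) * scaledNorm S (x' - x) ^ 2 := by
  have hforward := hS.neg_inner_add_le_of_cocoercive (d := x' - x) hℓ hc0 hc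
  have hforward' := mul_le_mul_of_nonneg_left hforward hγ
  rw [show x - z + (x' - x) = x' - z by abel] at hforward'
  -- From 2ab ≤ a² + b²: half of the momentum error is charged to the previous step D, half to the
  -- current one.
  have hmom : 2 * inner ℝ u (x' - x) ≤ L * (D ^ 2 + scaledNorm S (x' - x) ^ 2) := by
    have h1 := (le_abs_self _).trans (hS.abs_inner_le u (x' - x))
    have h2 := mul_le_mul_of_nonneg_right hu (scaledNorm_nonneg S (x' - x))
    nlinarith [mul_nonneg hL (sq_nonneg (D - scaledNorm S (x' - x)))]
  have hsplit : inner ℝ u (x' - z) = inner ℝ u (x - z) + inner ℝ u (x' - x) := by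
    rw [← inner_add_right]
    congr 1
    abel
  have hcosine : 2 * inner ℝ (S (x - x')) (x' - z) =
      scaledNorm S (x - z) ^ 2 - scaledNorm S (x' - z) ^ 2 - scaledNorm S (x' - x) ^ 2 := by
    simp only [hS.sq_scaledNorm]
    have h1 := hS.inner_map_comm x x'
    have h2 := hS.inner_map_comm x z
    have h3 := hS.inner_map_comm x' z
    simp only [map_sub, inner_sub_left, inner_sub_right]
    linarith
  rw [inner_sub_left, inner_sub_left, inner_add_left, inner_smul_left, RCLike.conj_to_real] at hmono
  linarith

theorem IsGenerated.mem_map {A : H → Set H} {C : H → H} {M : ℕ → H → H} {γ : ℕ → ℝ} {x u : ℕ → H}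
    (h : IsGenerated A C S M γ x u) (k : ℕ) :
    M k (x k) - M k (x (k + 1)) + (γ k)⁻¹ • u k - C (x k) ∈ A (x (k + 1)) := by
  obtain ⟨a, ha, hak⟩ := h.x_step k
  convert ha using 1
  rw [← sub_eq_iff_eq_add] at hak
  rw [← hak]
  abel

theorem IsGenerated.scaledNorm_inverse_le {A : H → Set H} {C : H → H} {M : ℕ → H → H}
    {γ L : ℕ → ℝ} {x u : ℕ → H} (hxu : IsGenerated A C S M γ x u)
    (hM : ∀ k : ℕ, LipschitzWrt S (L k) (fun y => γ k • M k y - S y)) (k : ℕ) :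
    scaledNorm S.inverse (u (k + 1)) ≤ L k * scaledNorm S (x (k + 1) - x k) := by
  rw [hxu.u_step k]
  exact (hM k).2 _ _

/-- The correction u_{k+1} is exactly the increment of γ_k M_k - S, so after scaling by γ_k only the
linear S remains. -/
theorem IsGenerated.smul_eq {A : H → Set H} {C : H → H} {M : ℕ → H → H} {γ : ℕ → ℝ} {x u : ℕ → H}
    (h : IsGenerated A C S M γ x u) {k : ℕ} (hk : γ k ≠ 0) :
    γ k • (M k (x k) - M k (x (k + 1)) + (γ k)⁻¹ • u k) =
      S (x k - x (k + 1)) + u k - u (k + 1) := by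
  rw [h.u_step k, smul_add, smul_inv_smul₀ hk, smul_sub, map_sub]
  abel

theorem mem_zer_sumOp_iff {H : Type*} [NormedAddCommGroup H] {A : H → Set H} {C : H → H} {z : H} :
    z ∈ zer (sumOp A C) ↔ -C z ∈ A z := by
  constructor
  · rintro ⟨a, ha, h⟩
    rwa [← eq_neg_of_add_eq_zero_left h.symm]
  · exact fun h => ⟨_, h, (neg_add_cancel _).symm⟩

end Method

/-- V is antitone and bounded below, hence convergent, and its vanishing decrements dominate ε D².
The term D 0 is not controlled, which is harmless in the limit. -/
theorem tendsto_of_sufficient_decrease {V D : ℕ → ℝ} {ε : ℝ} (hε : 0 < ε) (hV : ∀ k, 0 ≤ V k)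
    (hD : ∀ k, 0 ≤ D k) (h : ∀ k, V (k + 1) ≤ V k - ε * D (k + 1) ^ 2) :
    Antitone V ∧ (∃ l, Tendsto V atTop (𝓝 l)) ∧ Tendsto D atTop (𝓝 0) := by
  have hanti : Antitone V := antitone_nat_of_succ_le fun k =>
    (h k).trans (sub_le_self _ (by positivity))
  have hlim := tendsto_atTop_ciInf hanti ⟨0, by rintro _ ⟨k, rfl⟩; exact hV k⟩
  refine ⟨hanti, ⟨_, hlim⟩, ?_⟩
  have hdiff : Tendsto (fun k => (V k - V (k + 1)) / ε) atTop (𝓝 0) := by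
    simpa using (hlim.sub ((tendsto_add_atTop_iff_nat 1).2 hlim)).div_const ε
  have hsq : Tendsto (fun k => D (k + 1) ^ 2) atTop (𝓝 0) :=
    squeeze_zero (fun k => sq_nonneg _) (fun k => by
      rw [le_div_iff₀ hε]
      linarith [h k]) hdiff
  rw [← tendsto_add_atTop_iff_nat 1]
  simpa [Real.sqrt_sq (hD _)] using hsq.sqrt

/-! ### Energy convergence and weak cluster points -/

section Method

variable {H : Type*} [NormedAddCommGroup H] [InnerProductSpace ℝ H] [CompleteSpace H]
  {A : H → Set H} {C : H → H} {S : H →L[ℝ] H} {ℓ : ℝ} {M : ℕ → H → H} {γ L : ℕ → ℝ} {x u : ℕ → H}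

/-- Convergence of the energy of the method with respect to a fixed zero of `A + C`. -/
theorem IsGenerated.fejer (hA : IsMonotone A) (hS : SelfAdjointStronglyPositive S)
    (hC : CocoerciveWrt S ℓ C ∨ (C = 0 ∧ ℓ = 0)) (hγ : ∀ k, 0 < γ k)
    (hM : ∀ k : ℕ, LipschitzWrt S (L k) (fun y => γ k • M k y - S y))
    {ε : ℝ} (hε : 0 < ε) (hcond : ∀ k : ℕ, ε ≤ 1 - L k - L (k + 1) - γ (k + 1) * ℓ / 2)
    (hxu : IsGenerated A C S M γ x u) {z : H} (hz : -C z ∈ A z) :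
    Tendsto (fun k => scaledNorm S (x (k + 1) - x k)) atTop (𝓝 0) ∧
      Tendsto u atTop (𝓝 0) ∧ (∃ R, ∀ k, ‖x (k + 1)‖ ≤ R) ∧
      ∃ l, Tendsto (fun k => inner ℝ (S (x (k + 1) - z)) (x (k + 1) - z)) atTop (𝓝 l) := by
  obtain ⟨hℓ, hC0, hC1⟩ := cocoercive_bounds hC
  have hu := hxu.scaledNorm_inverse_le hM
  have hL : ∀ k, 0 ≤ L k := fun k => (hM k).1
  have hL1 : ∀ k, L k ≤ 1 - ε := fun k => by
    have := mul_nonneg (hγ (k + 1)).le hℓ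
    linarith [hcond k, hL (k + 1)]
  let D : ℕ → ℝ := fun k => scaledNorm S (x (k + 1) - x k)
  let V : ℕ → ℝ := fun k => scaledNorm S (x (k + 1) - z) ^ 2 +
    2 * inner ℝ (u (k + 1)) (x (k + 1) - z) + L k * D k ^ 2
  have hD : ∀ k, 0 ≤ D k := fun k => scaledNorm_nonneg _ _
  -- With r = ‖x_{k+1} - z‖_S, V k ≥ r² - 2 L D r + L D² = (1 - L) r² + L (D - r)², and 1 - L ≥ ε.
  have hVlow : ∀ k, ε * scaledNorm S (x (k + 1) - z) ^ 2 ≤ V k := fun k => by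
    have hr := scaledNorm_nonneg S (x (k + 1) - z)
    have h1 := (abs_le.1 (hS.abs_inner_le (u (k + 1)) (x (k + 1) - z))).1
    have h2 := mul_le_mul_of_nonneg_right (hu k) hr
    have h3 := mul_nonneg (hL k) (sq_nonneg (D k - scaledNorm S (x (k + 1) - z)))
    have h4 := mul_le_mul_of_nonneg_right (hL1 k) (sq_nonneg (scaledNorm S (x (k + 1) - z)))
    simp only [V, D] at *
    linarith
  have hV0 : ∀ k, 0 ≤ V k := fun k => le_trans (by positivity) (hVlow k)
  have hstep : ∀ k, V (k + 1) ≤ V k - ε * D (k + 1) ^ 2 := fun k => by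
    -- Monotonicity of A between the new iterate and z, multiplied by γ.
    have hm : 0 ≤ inner ℝ (S (x (k + 1) - x (k + 2)) + u (k + 1) - u (k + 2) -
        γ (k + 1) • (C (x (k + 1)) - C z)) (x (k + 2) - z) := by
      rw [← hxu.smul_eq (hγ (k + 1)).ne', ← smul_sub, inner_smul_left]
      refine mul_nonneg (hγ (k + 1)).le ?_
      have h1 := hA _ _ _ _ (hxu.mem_map (k + 1)) hz
      rwa [sub_neg_eq_add, sub_add] at h1
    have h1 := hS.energy_step (hγ (k + 1)).le hℓ (hL k) hm (hC0 _ _) (hC1 _ _) (hu k)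
    have h2 := mul_le_mul_of_nonneg_right (hcond k) (sq_nonneg (D (k + 1)))
    simp only [V, D] at *
    linarith
  obtain ⟨hanti, ⟨l, hl⟩, hD0⟩ := tendsto_of_sufficient_decrease hε hV0 hD hstep
  have hu0 : Tendsto (fun k => u (k + 1)) atTop (𝓝 0) :=
    hS.tendsto_of_scaledNorm_inverse (squeeze_zero (fun k => scaledNorm_nonneg _ _)
      (fun k => (hu k).trans (mul_le_of_le_one_left (hD k) (by linarith [hL1 k]))) hD0)
  obtain ⟨K, hK, hnorm⟩ := hS.exists_norm_le
  have hbound : ∀ k, ‖x (k + 1) - z‖ ≤ K * √(V 0 / ε) := fun k => by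
    refine (hnorm _).trans (mul_le_mul_of_nonneg_left (Real.le_sqrt_of_sq_le ?_) hK)
    rw [le_div_iff₀ hε]
    linarith [hVlow k, hanti (Nat.zero_le k)]
  refine ⟨hD0, (tendsto_add_atTop_iff_nat 1).1 hu0, ⟨K * √(V 0 / ε) + ‖z‖, fun k => ?_⟩, l, ?_⟩
  · have h1 := norm_add_le (x (k + 1) - z) z
    rw [sub_add_cancel] at h1
    exact h1.trans (by gcongr; exact hbound k)
  · have hcross : Tendsto (fun k => inner ℝ (u (k + 1)) (x (k + 1) - z)) atTop (𝓝 0) :=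
      squeeze_zero_norm (fun k => (norm_inner_le_norm _ _).trans
        (mul_le_mul_of_nonneg_left (hbound k) (norm_nonneg _)))
        (by simpa using hu0.norm.mul_const (K * √(V 0 / ε)))
    have hLD : Tendsto (fun k => L k * D k ^ 2) atTop (𝓝 0) :=
      squeeze_zero (fun k => mul_nonneg (hL k) (sq_nonneg _))
        (fun k => mul_le_of_le_one_left (sq_nonneg _) (by linarith [hL1 k]))
        (by simpa using hD0.pow 2)
    -- The cross term and L D² vanish, so the squared distance inherits the limit of V.
    have h1 := (hl.sub (hcross.const_mul 2)).sub hLD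
    rw [mul_zero, sub_zero, sub_zero] at h1
    refine h1.congr fun k => ?_
    rw [← hS.sq_scaledNorm]
    simp only [V]
    ring

theorem SelfAdjointStronglyPositive.tendsto_sub_of_cocoercive (hS : SelfAdjointStronglyPositive S)
    (hC : CocoerciveWrt S ℓ C ∨ (C = 0 ∧ ℓ = 0)) {ι : Type*} {F : Filter ι} {y : ι → H} {z : H}
    {b : ι → ℝ} (hb : Tendsto b F (𝓝 0)) (h : ∀ i, inner ℝ (C (y i) - C z) (y i - z) ≤ b i) :
    Tendsto (fun i => C (y i)) F (𝓝 (C z)) := by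
  obtain ⟨hℓ, -, hC1⟩ := cocoercive_bounds hC
  have hsq : Tendsto (fun i => scaledNorm S.inverse (C (y i) - C z) ^ 2) F (𝓝 0) :=
    squeeze_zero (fun i => sq_nonneg _)
      (fun i => (hC1 _ _).trans (mul_le_mul_of_nonneg_left (h i) hℓ)) (by simpa using hb.const_mul ℓ)
  have h1 := hsq.sqrt
  simp only [Real.sqrt_sq (scaledNorm_nonneg _ _), Real.sqrt_zero] at h1
  exact tendsto_sub_nhds_zero_iff.1 (hS.tendsto_of_scaledNorm_inverse h1)

/-- The graph of `A + C` is weak-strong closed at `0`, along bounded families. -/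
theorem IsMaximallyMonotone.neg_mem_of_tendsto (hA : IsMaximallyMonotone A)
    (hS : SelfAdjointStronglyPositive S) (hC : CocoerciveWrt S ℓ C ∨ (C = 0 ∧ ℓ = 0))
    {ι : Type*} {F : Filter ι} [F.NeBot] {v y : ι → H} {z y₀ : H} {R : ℝ} (hz : -C z ∈ A z)
    (hmem : ∀ i, v i - C (y i) ∈ A (y i)) (hv : Tendsto v F (𝓝 0)) (hR : ∀ i, ‖y i‖ ≤ R)
    (hy : ∀ w, Tendsto (fun i => inner ℝ (y i) w) F (𝓝 (inner ℝ y₀ w))) : -C y₀ ∈ A y₀ := by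
  have hweak : ∀ p w, Tendsto (fun i => inner ℝ (y i - p) w) F (𝓝 (inner ℝ (y₀ - p) w)) := by
    intro p w
    simpa only [inner_sub_left] using (hy w).sub_const _
  have hR' : ∀ p i, ‖y i - p‖ ≤ R + ‖p‖ := fun p i => (norm_sub_le _ _).trans (by gcongr; exact hR i)
  -- Monotonicity against the known zero z gives ⟨C y - C z, y - z⟩ ≤ ⟨v, y - z⟩ → 0, and
  -- cocoercivity turns this into strong convergence of C y.
  have hCz : Tendsto (fun i => C (y i)) F (𝓝 (C z)) := by
    refine hS.tendsto_sub_of_cocoercive hC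
      (by simpa using tendsto_inner_of_weak hv (hR' z) (hweak z)) fun i => ?_
    have h1 := hA.1 _ _ _ _ (hmem i) hz
    rw [show v i - C (y i) - -C z = v i - (C (y i) - C z) by abel, inner_sub_left] at h1
    linarith
  -- As C y converges strongly and y weakly to y₀, ⟨C y - C y₀, y - y₀⟩ → 0. Cocoercivity now
  -- identifies the limit as C y₀, and closedness of the graph of A suffices.
  have hCy₀ : Tendsto (fun i => C (y i)) F (𝓝 (C y₀)) :=
    hS.tendsto_sub_of_cocoercive hC (by
      simpa using tendsto_inner_of_weak (hCz.sub_const (C y₀)) (hR' y₀) (hweak y₀)) fun _ => le_rfl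
  refine hA.mem_of_tendsto hmem ?_ hR hy
  simpa using hv.sub hCy₀

end Method

end NonlinearFB

/-! ### Assembly of the main theorem -/

theorem theorem3p3 {H : Type*} [NormedAddCommGroup H] [InnerProductSpace ℝ H] [CompleteSpace H]
    (A : H → Set H) (C : H → H) (S : H →L[ℝ] H) (ℓ : ℝ)
    (M : ℕ → H → H) (γ L : ℕ → ℝ)
    -- the problem: `A` maximally monotone, `C` cocoercive w.r.t. `S` (with `ℓ = 0` if `C = 0`)
    (hA : NonlinearFB.IsMaximallyMonotone A)
    (hS : NonlinearFB.SelfAdjointStronglyPositive S)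
    (hC : NonlinearFB.CocoerciveWrt S ℓ C ∨ (C = 0 ∧ ℓ = 0))
    (hzer : (NonlinearFB.zer (NonlinearFB.sumOp A C)).Nonempty)
    -- the design parameters
    (hγ : ∃ γ₀ : ℝ, 0 < γ₀ ∧ ∀ k : ℕ, γ₀ ≤ γ k)
    (hM : ∀ k : ℕ, NonlinearFB.LipschitzWrt S (L k) (fun y => γ k • M k y - S y))
    -- the convergence condition, for all `k ≥ 1`
    (hcond : ∃ ε : ℝ, 0 < ε ∧ ∀ k : ℕ, 1 ≤ k → ε ≤ 1 - L (k - 1) - L k - γ k * ℓ / 2)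
    (x u : ℕ → H) (hxu : NonlinearFB.IsGenerated A C S M γ x u) :
    Tendsto (fun k : ℕ => x (k + 1) - x k) atTop (𝓝 0) ∧
    Tendsto u atTop (𝓝 0) ∧
    ((∀ k : ℕ, M k (x k) - M k (x (k + 1)) + (γ k)⁻¹ • u k + C (x (k + 1)) - C (x k) ∈
        NonlinearFB.sumOp A C (x (k + 1))) ∧
      Tendsto
        (fun k : ℕ =>
          M k (x k) - M k (x (k + 1)) + (γ k)⁻¹ • u k + C (x (k + 1)) - C (x k))
        atTop (𝓝 0)) ∧
    ∃ xstar ∈ NonlinearFB.zer (NonlinearFB.sumOp A C),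
      Tendsto (fun k : ℕ => toWeakSpace ℝ H (x k)) atTop (𝓝 (toWeakSpace ℝ H xstar)) := by
  obtain ⟨γ₀, hγ₀, hγ⟩ := hγ
  obtain ⟨ε, hε, hcond⟩ := hcond
  obtain ⟨z, hz⟩ := hzer
  have hγpos : ∀ k, 0 < γ k := fun k => hγ₀.trans_le (hγ k)
  have hcond' : ∀ k, ε ≤ 1 - L k - L (k + 1) - γ (k + 1) * ℓ / 2 := fun k => by
    simpa using hcond (k + 1) (Nat.le_add_left 1 k)
  -- Kept generic in the zero p: one zero gives the asymptotics, while Opial's lemma needs them all.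
  have hfejer := fun {p : H} => hxu.fejer (z := p) hA.1 hS hC hγpos hM hε hcond'
  rw [NonlinearFB.mem_zer_sumOp_iff] at hz
  obtain ⟨hD, hu, ⟨R, hR⟩, -⟩ := hfejer hz
  obtain ⟨hℓ, -, hC1⟩ := NonlinearFB.cocoercive_bounds hC
  have hd := hS.tendsto_of_scaledNorm hD
  have hCd : Tendsto (fun k => C (x (k + 1)) - C (x k)) atTop (𝓝 0) :=
    hS.tendsto_of_scaledNorm_inverse (squeeze_zero (fun _ => NonlinearFB.scaledNorm_nonneg _ _)
      (fun k => hS.scaledNorm_inverse_le_of_cocoercive hℓ (hC1 _ _))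
      (by simpa using hD.const_mul ℓ))
  let r : ℕ → H := fun k => M k (x k) - M k (x (k + 1)) + (γ k)⁻¹ • u k + C (x (k + 1)) - C (x k)
  have hrA : ∀ k, r k - C (x (k + 1)) ∈ A (x (k + 1)) := fun k => by
    convert hxu.mem_map k using 1
    simp only [r]
    abel
  have hr : Tendsto r atTop (𝓝 0) := by
    have h1 : Tendsto (fun k => S (x k - x (k + 1)) + u k - u (k + 1)) atTop (𝓝 0) := by
      have h2 := (((S.continuous.tendsto 0).comp hd).neg.add hu).sub
        ((tendsto_add_atTop_iff_nat 1).2 hu)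
      rw [map_zero, neg_zero, add_zero, sub_zero] at h2
      refine h2.congr fun k => ?_
      rw [Function.comp_apply, ← map_neg, neg_sub]
    -- Here the lower bound γ₀ enters: γ₀ times the norm is at most the norm of the γ k multiple,
    -- which vanishes by h1.
    have h3 : Tendsto (fun k => M k (x k) - M k (x (k + 1)) + (γ k)⁻¹ • u k) atTop (𝓝 0) := by
      refine squeeze_zero_norm (fun k => ?_) (by simpa using h1.norm.const_mul γ₀⁻¹)
      rw [← map_sub, ← hxu.smul_eq (hγpos k).ne', norm_smul, Real.norm_of_nonneg (hγpos k).le,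
        inv_mul_eq_div, le_div_iff₀ hγ₀, mul_comm]
      exact mul_le_mul_of_nonneg_right (hγ k) (norm_nonneg _)
    have h4 := h3.add hCd
    rw [add_zero] at h4
    exact h4.congr fun k => (add_sub_assoc _ _ _).symm
  refine ⟨hd, hu, ⟨fun k => ⟨_, hrA k, (sub_add_cancel _ _).symm⟩, hr⟩, ?_⟩
  -- Opial is applied to k ↦ x (k + 1), where the residual inclusions and the norm bound hold; the
  -- shift is undone at the end.
  obtain ⟨p, hp, hlim⟩ := hS.exists_weak_limit_of_fejer (Z := {p | -C p ∈ A p}) hR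
    (fun p hp => (hfejer hp).2.2.2)
    (fun F hF p hp => hA.neg_mem_of_tendsto hS hC hz hrA (hr.mono_left hF) hR hp)
  refine ⟨p, NonlinearFB.mem_zer_sumOp_iff.2 hp, ?_⟩
  rw [← tendsto_add_atTop_iff_nat 1]
  exact NonlinearFB.tendsto_toWeakSpace_iff.2 hlim
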